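/- For positive integers $n,k$ and $r\ge 1$, let $\mathrm{MP}_{n,r}^k$ be the set of permutations $\pi=\pi_1\cdots\pi_n$ of $\{1,\dots,n\}$ such that $\pi_i-i\equiv r-1 \pmod k$ for all $1\le i\le n$. Let $\mathrm{exc}(\pi)=|\{i:\pi_i>i\}|$, let $\mathcal A_n$ be the group of even permutations in the symmetric group $\mathfrak S_n$, and put $$\mathrm{MPE}_{n,r}^{k,+}(t)=\sum_{\pi\in \mathrm{MP}_{n,r}^k\cap\mathcal A_n}t^{\mathrm{exc}(\pi)},\qquad \mathrm{MPE}_{n,r}^{k,-}(t)=\sum_{\pi\in \mathrm{MP}_{n,r}^k\cap(\mathfrak S_n\setminus\mathcal A_n)}t^{\mathrm{exc}(\pi)}.$$ Let $f=\sum_i a_it^i\in\mathbb Q[t]$ be a nonzero polynomial of degree $d$, and let $s$ be the least exponent with $a_s\ne0$. The center of symmetry of $f$ is $(d+s)/2$. The polynomial $f$ is palindromic if $a_{s+i}=a_{d-i}$ for $0\le i\le\lfloor (d-s)/2\rfloor$. A palindromic $f$ is gamma-positive if $f(t)=\sum_{i=0}^{\lfloor (d-s)/2\rfloor}\gamma_i\,t^{s+i}(1+t)^{d-s-2i}$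 with all $\gamma_i\ge0$. **Theorem.** Let $n,k$ be positive integers with $n\equiv k\pmod{2k}$ and $n\ge5k$. Then $\mathrm{MPE}_{n,1}^{k,+}(t)$ and $\mathrm{MPE}_{n,1}^{k,-}(t)$ are gamma-positive with center of symmetry $(n-k)/2$. Moreover, for $2\le r\le k$, the polynomials $\mathrm{MPE}_{n,r}^{k,+}(t)$ and $\mathrm{MPE}_{n,r}^{k,-}(t)$ are gamma-positive with center of symmetry $(n+k)/2+1-r$. -/

import Mathlib

open Polynomial

/-- The number of excedances of a permutation, i.e. of indices `i` with `π_i > i`.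
The letters `1, …, n` are modelled by `Fin n = {0, …, n - 1}`; the shift by one affects neither
excedances, nor signs, nor differences `π_i - i`. -/
def exc {n : ℕ} (π : Equiv.Perm (Fin n)) : ℕ :=
  (Finset.univ.filter fun i : Fin n => i < π i).card

/-- Mod-`k`-alternating permutations of length `n` starting with the remainder `r` modulo `k`:
`π_i - i ≡ r - 1 (mod k)` for all `i`. -/
def MP (n k r : ℕ) : Finset (Equiv.Perm (Fin n)) :=
  Finset.univ.filter fun π =>
    ∀ i : Fin n, (((π i : Fin n) : ℕ) : ℤ) - ((i : ℕ) : ℤ) ≡ (r : ℤ) - 1 [ZMOD (k : ℤ)]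

open Classical in
/-- Excedance polynomial over the even permutations in `MP n k r`. -/
noncomputable def MPEplus (n k r : ℕ) : ℚ[X] :=
  ∑ π ∈ (MP n k r).filter (fun π => π ∈ alternatingGroup (Fin n)), X ^ exc π

open Classical in
/-- Excedance polynomial over the odd permutations in `MP n k r`. -/
noncomputable def MPEminus (n k r : ℕ) : ℚ[X] :=
  ∑ π ∈ (MP n k r).filter (fun π => π ∉ alternatingGroup (Fin n)), X ^ exc π

/-- The center of symmetry: the mean of the largest and the least exponent that occur. -/
noncomputable def centerOfSymmetry (f : ℚ[X]) : ℚ :=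
  ((f.natDegree : ℚ) + (f.natTrailingDegree : ℚ)) / 2

/-- A nonzero polynomial with degree `d` and least exponent `s` is palindromic if
`a_{s+i} = a_{d-i}` for `0 ≤ i ≤ ⌊(d - s)/2⌋`. -/
def IsPalindromic (f : ℚ[X]) : Prop :=
  f ≠ 0 ∧ ∀ i ≤ (f.natDegree - f.natTrailingDegree) / 2,
    f.coeff (f.natTrailingDegree + i) = f.coeff (f.natDegree - i)

/-- A palindromic polynomial with degree `d` and least exponent `s` is gamma-positive if its
coefficients in the expansion along `t^{s+i} (1+t)^{d-s-2i}`, `0 ≤ i ≤ ⌊(d - s)/2⌋`,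
are nonnegative. -/
def IsGammaPositive (f : ℚ[X]) : Prop :=
  IsPalindromic f ∧ ∃ γ : ℕ → ℚ, (∀ i, 0 ≤ γ i) ∧
    f = ∑ i ∈ Finset.range ((f.natDegree - f.natTrailingDegree) / 2 + 1),
      C (γ i) * X ^ (f.natTrailingDegree + i) *
        (1 + X) ^ (f.natDegree - f.natTrailingDegree - 2 * i)

/-! The idea: write `S(t) = ∑ sgn(π) t ^ exc(π)` and `A(t) = ∑ t ^ exc(π)`, so that the even and odd
parts are `(A ± S) / 2`. A mod-`k`-alternating permutation of length `(2m + 1) k` splits into `k`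
arbitrary permutations of length `2m + 1`, one for each residue, and each contributes its excedances
or its weak excedances. Hence `A` and `S` are, up to a sign and a common power of `t`, the `k`-th
powers of the Eulerian polynomial `A_{2m+1}(t)` and of its signed analogue `(1 - t) ^ (2m)`. Products
preserve the property that half-sum and half-difference are gamma-positive, so it suffices to treat
`k = 1`. There `(1 - t) ^ (2m) = ((1 + t) ^ 2 - 4t) ^ m`, which is dominated by
`((1 + t) ^ 2 + 4t) ^ m`, which in turn is dominated by `A_{2m+1}(t)` as soon as `m ≥ 2`. -/

section Reciprocal

variable {R : Type*} [Semiring R]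

theorem reflect_pow {f : R[X]} {N : ℕ} (hf : f.natDegree ≤ N) (n : ℕ) :
    reflect (n * N) (f ^ n) = reflect N f ^ n := by
  induction n with
  | zero => simp
  | succ n ih =>
    rw [pow_succ, pow_succ, add_one_mul, reflect_mul _ _ (natDegree_pow_le_of_le n hf) hf, ih]

theorem coeff_sub_of_reflect_eq {f : R[X]} {N l : ℕ} (hf : reflect N f = f) (hl : l ≤ N) :
    f.coeff (N - l) = f.coeff l := by
  rw [← revAt_le hl, ← coeff_reflect, hf]

theorem natDegree_add_natTrailingDegree_of_reflect_eq {f : R[X]} {N : ℕ} (h0 : f ≠ 0)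
    (hdeg : f.natDegree ≤ N) (hf : reflect N f = f) :
    f.natDegree + f.natTrailingDegree = N := by
  have hle : f.natTrailingDegree ≤ N - f.natDegree := by
    apply natTrailingDegree_le_of_ne_zero
    rw [coeff_sub_of_reflect_eq hf hdeg]
    exact leadingCoeff_ne_zero.2 h0
  have hge : N - f.natTrailingDegree ≤ f.natDegree := by
    apply le_natDegree_of_ne_zero
    rw [coeff_sub_of_reflect_eq hf ((natTrailingDegree_le_natDegree f).trans hdeg)]
    exact trailingCoeff_nonzero_iff_nonzero.2 h0
  omega

end Reciprocal

theorem isPalindromic_of_reflect_eq {f : ℚ[X]} {N : ℕ} (h0 : f ≠ 0) (hdeg : f.natDegree ≤ N)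
    (hf : reflect N f = f) : IsPalindromic f := by
  have hN := natDegree_add_natTrailingDegree_of_reflect_eq h0 hdeg hf
  refine ⟨h0, fun i hi => ?_⟩
  have hle := natTrailingDegree_le_natDegree f
  rw [← coeff_sub_of_reflect_eq hf (by omega)]
  congr 1
  omega

section GammaCone

/-- The cone of the polynomials with an expansion along the `t^i (1+t)^j`, `2 i + j = N`, whose
(gamma) coefficients are nonnegative rationals. The center of symmetry of each of them is `N / 2`.
-/
noncomputable def gammaCone (R : Type*) [CommSemiring R] [Algebra ℚ≥0 R] (N : ℕ) :
    Submodule ℚ≥0 R[X] :=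
  Submodule.span ℚ≥0 {f | ∃ i j, 2 * i + j = N ∧ f = X ^ i * (1 + X) ^ j}

variable {R : Type*} [CommSemiring R] [Algebra ℚ≥0 R] {N : ℕ} {f : R[X]}

theorem X_pow_mul_one_add_X_pow_mem_gammaCone {i j : ℕ} (h : 2 * i + j = N) :
    (X ^ i * (1 + X) ^ j : R[X]) ∈ gammaCone R N :=
  Submodule.subset_span ⟨i, j, h, rfl⟩

theorem X_pow_mem_gammaCone (w : ℕ) : (X ^ w : R[X]) ∈ gammaCone R (2 * w) := by
  simpa using X_pow_mul_one_add_X_pow_mem_gammaCone (R := R) (i := w) (j := 0) rfl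

theorem one_add_X_pow_mem_gammaCone (j : ℕ) : ((1 + X) ^ j : R[X]) ∈ gammaCone R j := by
  simpa using X_pow_mul_one_add_X_pow_mem_gammaCone (R := R) (i := 0) (j := j) (by simp)

instance : SetLike.GradedMonoid (gammaCone R) where
  one_mem := by simpa using X_pow_mem_gammaCone (R := R) 0
  mul_mem := by
    intro N M f g hf hg
    have hfg := Submodule.mul_mem_mul hf hg
    rw [gammaCone, gammaCone, Submodule.span_mul_span] at hfg
    refine Submodule.span_mono ?_ hfg
    rintro _ ⟨_, ⟨i, j, rfl, rfl⟩, _, ⟨i', j', rfl, rfl⟩, rfl⟩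
    exact ⟨i + i', j + j', by ring, by ring⟩

theorem natDegree_le_of_mem_gammaCone (hf : f ∈ gammaCone R N) : f.natDegree ≤ N := by
  induction hf using Submodule.span_induction with
  | zero => simp
  | add x y _ _ hx hy => exact natDegree_add_le_of_degree_le hx hy
  | smul c x _ hx => exact (natDegree_smul_le c x).trans hx
  | mem x hx =>
    obtain ⟨i, j, rfl, rfl⟩ := hx
    compute_degree
    omega

theorem reflect_eq_of_mem_gammaCone (hf : f ∈ gammaCone R N) : reflect N f = f := by
  induction hf using Submodule.span_induction with
  | zero => simp
  | add x y _ _ hx hy => rw [reflect_add, hx, hy]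
  | smul c x _ hx =>
    rw [← algebraMap_smul R c x, smul_eq_C_mul, reflect_C_mul, hx]
  | mem x hx =>
    obtain ⟨i, j, rfl, rfl⟩ := hx
    have hX : reflect (2 * i) (X ^ i : R[X]) = X ^ i := by
      rw [reflect_monomial, revAt_le (by omega), two_mul, Nat.add_sub_cancel]
    have hone_add_X : reflect j ((1 + X) ^ j : R[X]) = (1 + X) ^ j := by
      simpa [reflect_add, reflect_one, add_comm] using
        reflect_pow (show (1 + X : R[X]).natDegree ≤ 1 by compute_degree) j
    rw [reflect_mul _ _ (by compute_degree; omega) (by compute_degree), hX, hone_add_X]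

theorem exists_gamma_of_mem_gammaCone (hf : f ∈ gammaCone R N) :
    ∃ γ : ℕ → ℚ≥0, f = ∑ i ∈ Finset.range (N / 2 + 1), γ i • (X ^ i * (1 + X) ^ (N - 2 * i)) := by
  induction hf using Submodule.span_induction with
  | zero => exact ⟨0, by simp⟩
  | add x y _ _ hx hy =>
    obtain ⟨γ, rfl⟩ := hx
    obtain ⟨γ', rfl⟩ := hy
    exact ⟨γ + γ', by simp only [Pi.add_apply, add_smul, Finset.sum_add_distrib]⟩
  | smul c x _ hx =>
    obtain ⟨γ, rfl⟩ := hx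
    exact ⟨c • γ, by simp only [Pi.smul_apply, smul_assoc, Finset.smul_sum]⟩
  | mem x hx =>
    obtain ⟨i, j, rfl, rfl⟩ := hx
    refine ⟨Pi.single i 1, ?_⟩
    rw [Finset.sum_eq_single_of_mem i (Finset.mem_range.2 (by omega))]
    · simp
    · intro l _ hl
      rw [Pi.single_eq_of_ne hl, zero_smul]

theorem gamma_eq_zero_of_lt_natTrailingDegree [Nontrivial R] {γ : ℕ → ℚ≥0}
    (hf : f = ∑ i ∈ Finset.range (N / 2 + 1), γ i • (X ^ i * (1 + X) ^ (N - 2 * i)))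
    {i : ℕ} (hiN : i ≤ N / 2) (hi : i < f.natTrailingDegree) : γ i = 0 := by
  have hcoeff : algebraMap ℚ≥0 R (∑ l ∈ Finset.range (N / 2 + 1),
      γ l * (if l ≤ i then ((N - 2 * l).choose (i - l) : ℚ≥0) else 0)) = 0 := by
    rw [← coeff_eq_zero_of_lt_natTrailingDegree hi, hf]
    simp [finsetSum_coeff, coeff_X_pow_mul', coeff_one_add_X_pow, Algebra.smul_def, apply_ite]
  have hterm := Finset.sum_eq_zero_iff.1 ((map_eq_zero _).1 hcoeff) i
    (Finset.mem_range.2 (by omega))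
  simpa using hterm

theorem isGammaPositive_of_mem_gammaCone {f : ℚ[X]} (hf : f ∈ gammaCone ℚ N) (h0 : f ≠ 0) :
    IsGammaPositive f := by
  have hdeg := natDegree_le_of_mem_gammaCone hf
  have hrefl := reflect_eq_of_mem_gammaCone hf
  have hN := natDegree_add_natTrailingDegree_of_reflect_eq h0 hdeg hrefl
  have hle := natTrailingDegree_le_natDegree f
  obtain ⟨γ, hγ⟩ := exists_gamma_of_mem_gammaCone hf
  refine ⟨isPalindromic_of_reflect_eq h0 hdeg hrefl,
    fun i => γ (f.natTrailingDegree + i), fun i => NNRat.cast_nonneg _, ?_⟩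
  have hlow : ∑ i ∈ Finset.range f.natTrailingDegree,
      γ i • (X ^ i * (1 + X : ℚ[X]) ^ (N - 2 * i)) = 0 :=
    Finset.sum_eq_zero fun i hi => by
      have hi := Finset.mem_range.1 hi
      rw [gamma_eq_zero_of_lt_natTrailingDegree hγ (by omega) hi, zero_smul]
  conv_lhs => rw [hγ, show N / 2 + 1 = f.natTrailingDegree +
    ((f.natDegree - f.natTrailingDegree) / 2 + 1) by omega, Finset.sum_range_add, hlow, zero_add]
  refine Finset.sum_congr rfl fun i _ => ?_
  rw [show f.natDegree - f.natTrailingDegree - 2 * i = N - 2 * (f.natTrailingDegree + i) by omega,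
    mul_assoc, ← smul_eq_C_mul]
  rfl

theorem centerOfSymmetry_of_mem_gammaCone {f : ℚ[X]} (hf : f ∈ gammaCone ℚ N) (h0 : f ≠ 0) :
    centerOfSymmetry f = N / 2 := by
  rw [centerOfSymmetry, ← natDegree_add_natTrailingDegree_of_reflect_eq h0
    (natDegree_le_of_mem_gammaCone hf) (reflect_eq_of_mem_gammaCone hf), Nat.cast_add]

end GammaCone

section ParityGammaCone

/-- The pairs of an unsigned generating function `p + q` and a signed generating function `p - q`
whose even part `p` and odd part `q` lie in `gammaCone R N`. -/
noncomputable def parityGammaCone (R : Type*) [CommRing R] [Algebra ℚ≥0 R] (N : ℕ) :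
    Submodule ℚ≥0 (R[X] × R[X]) where
  carrier := {f | ∃ p ∈ gammaCone R N, ∃ q ∈ gammaCone R N, f = (p + q, p - q)}
  zero_mem' := ⟨0, zero_mem _, 0, zero_mem _, by simp only [add_zero, sub_zero, Prod.mk_zero_zero]⟩
  add_mem' := by
    rintro _ _ ⟨p, hp, q, hq, rfl⟩ ⟨p', hp', q', hq', rfl⟩
    exact ⟨p + p', add_mem hp hp', q + q', add_mem hq hq', by
      ext1 <;> simp only [Prod.mk_add_mk] <;> ring⟩
  smul_mem' := by
    rintro c _ ⟨p, hp, q, hq, rfl⟩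
    exact ⟨c • p, Submodule.smul_mem _ c hp, c • q, Submodule.smul_mem _ c hq, by
      rw [Prod.smul_mk, smul_add, smul_sub]⟩

variable {R : Type*} [CommRing R] [Algebra ℚ≥0 R] {N : ℕ}

theorem mk_mem_parityGammaCone {p q : R[X]} (hp : p ∈ gammaCone R N)
    (hq : q ∈ gammaCone R N) : (p + q, p - q) ∈ parityGammaCone R N :=
  ⟨p, hp, q, hq, rfl⟩

instance : SetLike.GradedMonoid (parityGammaCone R) where
  one_mem :=
    ⟨1, SetLike.one_mem_graded _, 0, zero_mem _, by simp only [add_zero, sub_zero, Prod.mk_one_one]⟩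
  mul_mem := by
    rintro N M _ _ ⟨p, hp, q, hq, rfl⟩ ⟨p', hp', q', hq', rfl⟩
    convert mk_mem_parityGammaCone
      (add_mem (SetLike.mul_mem_graded hp hp') (SetLike.mul_mem_graded hq hq'))
      (add_mem (SetLike.mul_mem_graded hp hq') (SetLike.mul_mem_graded hq hp')) using 1
    ext1 <;> simp only [Prod.mk_mul_mk] <;> ring

theorem mk_units_smul_mem_parityGammaCone {a b : R[X]} (h : (a, b) ∈ parityGammaCone R N)
    (ε : ℤˣ) : (a, ε • b) ∈ parityGammaCone R N := by
  obtain ⟨p, hp, q, hq, hab⟩ := h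
  obtain ⟨rfl, rfl⟩ := Prod.mk.inj hab
  rcases Int.units_eq_one_or ε with rfl | rfl
  · simpa using mk_mem_parityGammaCone hp hq
  · simpa [add_comm] using mk_mem_parityGammaCone hq hp

end ParityGammaCone

section ExcedancePolynomial

/-- The excedance polynomial of a set of permutations, twisted by a character `χ` of the sign: the
unsigned one for `χ = 1` and the signed one for `χ = signCharacter R`. -/
noncomputable def excPoly {R : Type*} [Semiring R] (χ : ℤˣ →* R) {n : ℕ}
    (s : Finset (Equiv.Perm (Fin n))) : R[X] :=
  ∑ π ∈ s, χ (Equiv.Perm.sign π) • X ^ exc π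

/-- The excedance polynomial of the permutations in `s` of sign `δ`. -/
noncomputable def signPart (R : Type*) [Semiring R] {n : ℕ} (s : Finset (Equiv.Perm (Fin n)))
    (δ : ℤˣ) : R[X] :=
  ∑ π ∈ s with Equiv.Perm.sign π = δ, X ^ exc π

/-- The inclusion of the signs `±1` into a ring. -/
def signCharacter (R : Type*) [Ring R] : ℤˣ →* R :=
  (Int.castRingHom R : ℤ →* R).comp (Units.coeHom ℤ)

variable {R : Type*} {n : ℕ} (s : Finset (Equiv.Perm (Fin n))) (δ : ℤˣ)

theorem signCharacter_smul [Ring R] (f : R[X]) : signCharacter R δ • f = δ • f := by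
  rw [Units.smul_def]
  exact Int.cast_smul_eq_zsmul R (δ : ℤ) f

theorem eval_one_excPoly_one [CommSemiring R] : (excPoly (1 : ℤˣ →* R) s).eval 1 = s.card := by
  simp [excPoly, eval_finsetSum]

theorem excPoly_one_eq_signPart_add [Semiring R] :
    excPoly (1 : ℤˣ →* R) s = signPart R s δ + signPart R s (-δ) := by
  simp only [excPoly, signPart, MonoidHom.one_apply, one_smul]
  rw [← Finset.sum_filter_add_sum_filter_not s (fun π => Equiv.Perm.sign π = δ)]
  simp only [Int.units_ne_iff_eq_neg]

theorem excPoly_signCharacter_eq_smul_signPart_sub [Ring R] :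
    excPoly (signCharacter R) s = δ • (signPart R s δ - signPart R s (-δ)) := by
  have hconst : ∀ ε : ℤˣ, ∑ π ∈ s with Equiv.Perm.sign π = ε,
      signCharacter R (Equiv.Perm.sign π) • (X : R[X]) ^ exc π = ε • signPart R s ε := fun ε => by
    rw [signPart, Finset.smul_sum]
    refine Finset.sum_congr rfl fun π hπ => ?_
    rw [(Finset.mem_filter.1 hπ).2, signCharacter_smul]
  rw [excPoly, ← Finset.sum_filter_add_sum_filter_not s (fun π => Equiv.Perm.sign π = δ)]
  simp only [Int.units_ne_iff_eq_neg]
  rw [hconst, hconst, smul_sub, Units.neg_smul, sub_eq_add_neg]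

variable {s}

theorem signPart_ne_zero [Ring R] (hone : (excPoly (1 : ℤˣ →* R) s).eval 1 ≠ 0)
    (hsign : (excPoly (signCharacter R) s).eval 1 = 0) : signPart R s δ ≠ 0 := by
  intro h
  rw [excPoly_one_eq_signPart_add s δ, h, zero_add] at hone
  rw [excPoly_signCharacter_eq_smul_signPart_sub s (-δ), neg_neg, h, sub_zero] at hsign
  rcases Int.units_eq_one_or δ with rfl | rfl <;> simp_all

theorem signPart_mem_gammaCone [CommRing R] [Algebra ℚ≥0 R] {N : ℕ}
    (h : (excPoly (1 : ℤˣ →* R) s, excPoly (signCharacter R) s) ∈ parityGammaCone R N) :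
    signPart R s δ ∈ gammaCone R N := by
  rw [excPoly_one_eq_signPart_add s δ, excPoly_signCharacter_eq_smul_signPart_sub s δ] at h
  obtain ⟨p, hp, q, -, hpq⟩ := mk_units_smul_mem_parityGammaCone h δ
  rw [smul_smul, Int.units_mul_self, one_smul] at hpq
  obtain ⟨hadd, hsub⟩ := Prod.mk.inj hpq
  have htwo : (2 : ℚ≥0) • signPart R s δ = (2 : ℚ≥0) • p := by
    rw [two_smul, two_smul]
    linear_combination hadd + hsub
  rwa [smul_right_injective R[X] (two_ne_zero (α := ℚ≥0)) htwo]

end ExcedancePolynomial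

section Eulerian

variable {R : Type*} [CommRing R] {n : ℕ}

/-- The operator that describes the effect on excedance polynomials of inserting a further letter
into an existing cycle of a permutation of `n` letters. -/
noncomputable def insertionOperator (R : Type*) [CommRing R] (n : ℕ) : R[X] →ₗ[R] R[X] :=
  LinearMap.mulLeft R ((n : R[X]) * X) + LinearMap.mulLeft R (X * (1 - X)) ∘ₗ derivative

theorem insertionOperator_apply (n : ℕ) (f : R[X]) :
    insertionOperator R n f = (n : R[X]) * X * f + X * (1 - X) * derivative f :=
  rfl

theorem X_mul_derivative_X_pow (e : ℕ) : (X : R[X]) * derivative (X ^ e) = (e : R[X]) * X ^ e := by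
  cases e with
  | zero => simp
  | succ e => simp only [derivative_X_pow_succ, map_add, map_natCast, map_one]; push_cast; ring

theorem exc_decomposeFin_symm_zero (σ : Equiv.Perm (Fin n)) :
    exc (Equiv.Perm.decomposeFin.symm (0, σ)) = exc σ := by
  rw [exc, Fin.card_filter_univ_succ]
  simp [exc]

theorem exc_decomposeFin_symm_succ (σ : Equiv.Perm (Fin n)) (j : Fin n) :
    exc (Equiv.Perm.decomposeFin.symm ((σ j).succ, σ)) = if j < σ j then exc σ else exc σ + 1 := by
  have herase : (Finset.univ.filter fun i : Fin n =>
      i.succ < Equiv.Perm.decomposeFin.symm ((σ j).succ, σ) i.succ) =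
        (Finset.univ.filter fun i => i < σ i).erase j := by
    ext i
    rw [Finset.mem_erase, Finset.mem_filter, Finset.mem_filter,
      Equiv.Perm.decomposeFin_symm_apply_succ]
    by_cases hij : i = j
    · simp [hij]
    · rw [Equiv.swap_apply_of_ne_of_ne (Fin.succ_ne_zero _) (by simpa using hij)]
      simp [hij]
  rw [exc, Fin.card_filter_univ_succ, herase]
  split_ifs with hzero hj hj
  · exact Finset.card_erase_add_one (by simpa using hj)
  · rw [Finset.erase_eq_of_notMem (by simpa using hj), exc]
  all_goals simp at hzero

theorem sum_X_pow_exc_decomposeFin_symm_succ (σ : Equiv.Perm (Fin n)) :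
    ∑ p : Fin n, (X : R[X]) ^ exc (Equiv.Perm.decomposeFin.symm (p.succ, σ)) =
      insertionOperator R n (X ^ exc σ) := by
  have hterm : ∀ j, (X : R[X]) ^ exc (Equiv.Perm.decomposeFin.symm ((σ j).succ, σ)) =
      X * X ^ exc σ + (if j < σ j then 1 else 0) * ((1 - X) * X ^ exc σ) := fun j => by
    rw [exc_decomposeFin_symm_succ]
    split_ifs <;> ring
  have hcard : ∑ j, (if j < σ j then (1 : R[X]) else 0) = (exc σ : R[X]) := by
    rw [Finset.sum_boole, exc]
  calc ∑ p : Fin n, (X : R[X]) ^ exc (Equiv.Perm.decomposeFin.symm (p.succ, σ))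
      = ∑ j, (X * X ^ exc σ + (if j < σ j then 1 else 0) * ((1 - X) * X ^ exc σ)) := by
        rw [← Equiv.sum_comp σ]
        exact Finset.sum_congr rfl fun j _ => hterm j
    _ = (n : R[X]) * (X * X ^ exc σ) + (exc σ : R[X]) * ((1 - X) * X ^ exc σ) := by
        rw [Finset.sum_add_distrib, Finset.sum_const, Finset.card_univ, Fintype.card_fin,
          nsmul_eq_mul, ← Finset.sum_mul, hcard]
    _ = insertionOperator R n (X ^ exc σ) := by
        rw [insertionOperator_apply]
        linear_combination (X - 1) * X_mul_derivative_X_pow (R := R) (exc σ)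

/-- The Eulerian polynomial, as the excedance polynomial of the symmetric group, twisted by a
character of the sign. -/
noncomputable def twistedEulerian (χ : ℤˣ →* R) (n : ℕ) : R[X] :=
  excPoly χ (Finset.univ : Finset (Equiv.Perm (Fin n)))

theorem twistedEulerian_zero (χ : ℤˣ →* R) : twistedEulerian χ 0 = 1 := by
  simp [twistedEulerian, excPoly, exc]

theorem twistedEulerian_succ (χ : ℤˣ →* R) (n : ℕ) :
    twistedEulerian χ (n + 1) =
      twistedEulerian χ n + χ (-1) • insertionOperator R n (twistedEulerian χ n) := by
  rw [twistedEulerian, excPoly, ← Equiv.sum_comp Equiv.Perm.decomposeFin.symm,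
    Fintype.sum_prod_type, Fin.sum_univ_succ]
  congr 1
  · refine Finset.sum_congr rfl fun σ _ => ?_
    rw [exc_decomposeFin_symm_zero, Equiv.Perm.decomposeFin.symm_sign, if_pos rfl, one_mul]
  · rw [Finset.sum_comm, twistedEulerian, excPoly, map_sum, Finset.smul_sum]
    refine Finset.sum_congr rfl fun σ _ => ?_
    simp only [Equiv.Perm.decomposeFin.symm_sign, Fin.succ_ne_zero, if_false, map_mul,
      ← Finset.smul_sum, sum_X_pow_exc_decomposeFin_symm_succ, map_smul, smul_smul]

theorem insertionOperator_one_sub_X_pow (n : ℕ) :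
    insertionOperator R (n + 1) ((1 - X) ^ n) = X * (1 - X) ^ n := by
  cases n with
  | zero => simp [insertionOperator_apply]
  | succ n =>
    simp only [insertionOperator_apply, derivative_pow_succ, derivative_sub, derivative_one,
      derivative_X, map_add, map_natCast, map_one]
    push_cast
    ring

theorem twistedEulerian_signCharacter_succ (n : ℕ) :
    twistedEulerian (signCharacter R) (n + 1) = (1 - X) ^ n := by
  induction n with
  | zero => simp [twistedEulerian_succ, twistedEulerian_zero, insertionOperator_apply]
  | succ n ih =>
    rw [twistedEulerian_succ, ih, insertionOperator_one_sub_X_pow, signCharacter_smul,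
      Units.neg_smul, one_smul]
    ring

/-- The operator that sends the `n`-th Eulerian polynomial to the next one. -/
noncomputable def eulerianStep (R : Type*) [CommRing R] (n : ℕ) : R[X] →ₗ[R] R[X] :=
  LinearMap.id + insertionOperator R n

theorem twistedEulerian_one_succ (n : ℕ) :
    twistedEulerian (1 : ℤˣ →* R) (n + 1) = eulerianStep R n (twistedEulerian 1 n) := by
  rw [twistedEulerian_succ, MonoidHom.one_apply, one_smul]
  rfl

theorem eulerianStep_X_pow_mul_one_add_X_pow (i j : ℕ) :
    eulerianStep R (2 * i + j + 1) (X ^ i * (1 + X) ^ j) =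
      (i + 1) • (X ^ i * (1 + X) ^ (j + 1)) +
        (2 * j) • (X ^ (i + 1) * (1 + X) ^ (j - 1)) := by
  have hder : derivative ((1 + X : R[X]) ^ j) = (j : R[X]) * (1 + X) ^ (j - 1) := by
    simp [derivative_pow]
  have hpow : (j : R[X]) * (1 + X) ^ j = (j : R[X]) * ((1 + X) ^ (j - 1) * (1 + X)) := by
    cases j <;> simp [pow_succ]
  simp only [eulerianStep, LinearMap.add_apply, LinearMap.id_apply, insertionOperator_apply,
    derivative_mul, hder, nsmul_eq_mul]
  push_cast
  linear_combination (1 - X) * (1 + X) ^ j * X_mul_derivative_X_pow (R := R) i + X ^ (i + 1) * hpow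

theorem eulerianStep_eulerianStep_X_pow_mul_one_add_X_pow (i j : ℕ) :
    eulerianStep R (2 * i + j + 2) (eulerianStep R (2 * i + j + 1) (X ^ i * (1 + X) ^ j)) =
      (i + 1) ^ 2 • (X ^ i * (1 + X) ^ (j + 2)) +
        (2 * (i + 1) * (j + 1) + 2 * j * (i + 2)) • (X ^ (i + 1) * (1 + X) ^ j) +
        (4 * j * (j - 1)) • (X ^ (i + 2) * (1 + X) ^ (j - 2)) := by
  rw [eulerianStep_X_pow_mul_one_add_X_pow, map_add, map_nsmul, map_nsmul,
    show 2 * i + j + 2 = 2 * i + (j + 1) + 1 by ring, eulerianStep_X_pow_mul_one_add_X_pow]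
  rcases j with _ | j
  · simp only [mul_zero, zero_mul, add_zero, nsmul_eq_mul]
    push_cast
    ring
  · rw [show 2 * i + (j + 1 + 1) + 1 = 2 * (i + 1) + (j + 1 - 1) + 1 by simp; ring,
      eulerianStep_X_pow_mul_one_add_X_pow]
    simp only [Nat.add_sub_cancel, show j + 1 - 2 = j - 1 by omega, nsmul_eq_mul]
    push_cast
    ring

theorem twistedEulerian_one_five :
    twistedEulerian (1 : ℤˣ →* R) 5 =
      (1 + X) ^ 4 + 22 * (X * (1 + X) ^ 2) + 16 * X ^ 2 := by
  have hone : twistedEulerian (1 : ℤˣ →* R) 1 = 1 := by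
    simp [twistedEulerian_succ, twistedEulerian_zero, insertionOperator_apply]
  have hthree : twistedEulerian (1 : ℤˣ →* R) 3 = (1 + X) ^ 2 + 2 * X := by
    rw [twistedEulerian_one_succ, twistedEulerian_one_succ, hone]
    simpa using eulerianStep_eulerianStep_X_pow_mul_one_add_X_pow (R := R) 0 0
  have hsq : eulerianStep R 4 (eulerianStep R 3 ((1 + X) ^ 2)) =
      (1 + X) ^ 4 + 14 * (X * (1 + X) ^ 2) + 8 * X ^ 2 := by
    simpa using eulerianStep_eulerianStep_X_pow_mul_one_add_X_pow (R := R) 0 2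
  have hX : eulerianStep R 4 (eulerianStep R 3 X) = 4 * (X * (1 + X) ^ 2) + 4 * X ^ 2 := by
    simpa using eulerianStep_eulerianStep_X_pow_mul_one_add_X_pow (R := R) 1 0
  rw [twistedEulerian_one_succ, twistedEulerian_one_succ, hthree, two_mul, map_add, map_add,
    map_add, map_add, hsq, hX]
  ring

variable [Algebra ℚ≥0 R]

theorem four_mul_X_mem_gammaCone : (4 * X : R[X]) ∈ gammaCone R 2 := by
  simpa using nsmul_mem (X_pow_mem_gammaCone (R := R) 1) 4

theorem one_add_X_sq_add_four_mul_X_mem_gammaCone :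
    ((1 + X) ^ 2 + 4 * X : R[X]) ∈ gammaCone R 2 :=
  add_mem (one_add_X_pow_mem_gammaCone 2) four_mul_X_mem_gammaCone

theorem eulerianStep_eulerianStep_sub_mem_gammaCone {N : ℕ} (hN : 0 < N) {f : R[X]}
    (hf : f ∈ gammaCone R N) :
    eulerianStep R (N + 2) (eulerianStep R (N + 1) f) - ((1 + X) ^ 2 + 4 * X) * f ∈
      gammaCone R (N + 2) := by
  induction hf using Submodule.span_induction with
  | zero => simp
  | add x y _ _ hx hy =>
    rw [map_add, map_add, mul_add, add_sub_add_comm]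
    exact add_mem hx hy
  | smul c x _ hx =>
    rw [← algebraMap_smul R c x, map_smul, map_smul, mul_smul_comm, ← smul_sub, algebraMap_smul]
    exact Submodule.smul_mem _ c hx
  | mem x hx =>
    obtain ⟨i, j, rfl, rfl⟩ := hx
    obtain ⟨c, hc⟩ : ∃ c, 2 * (i + 1) * (j + 1) + 2 * j * (i + 2) = c + 4 :=
      Nat.exists_eq_add_of_le' (by rcases i with _ | i <;> rcases j with _ | j <;> grind)
    have hlast : (4 * j * (j - 1)) • (X ^ (i + 2) * (1 + X) ^ (j - 2) : R[X]) ∈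
        gammaCone R (2 * i + j + 2) := by
      rcases lt_or_ge j 2 with hj | hj
      · interval_cases j <;> simp
      · exact nsmul_mem (X_pow_mul_one_add_X_pow_mem_gammaCone (by omega)) _
    have hfirst := nsmul_mem (X_pow_mul_one_add_X_pow_mem_gammaCone (R := R)
      (show 2 * i + (j + 2) = 2 * i + j + 2 by ring)) (i * (i + 2))
    have hmiddle := nsmul_mem (X_pow_mul_one_add_X_pow_mem_gammaCone (R := R)
      (show 2 * (i + 1) + j = 2 * i + j + 2 by ring)) c
    rw [eulerianStep_eulerianStep_X_pow_mul_one_add_X_pow, hc]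
    convert add_mem (add_mem hfirst hmiddle) hlast using 1
    simp only [nsmul_eq_mul]
    push_cast
    ring

theorem twistedEulerian_one_sub_pow_mem_gammaCone {m : ℕ} (hm : 2 ≤ m) :
    twistedEulerian (1 : ℤˣ →* R) (2 * m + 1) - ((1 + X) ^ 2 + 4 * X) ^ m ∈
      gammaCone R (2 * m) := by
  induction m, hm using Nat.le_induction with
  | base =>
    convert nsmul_mem (X_pow_mul_one_add_X_pow_mem_gammaCone (R := R)
      (show 2 * 1 + 2 = 2 * 2 by rfl)) 14 using 1
    rw [twistedEulerian_one_five, nsmul_eq_mul]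
    push_cast
    ring
  | succ m hm ih =>
    have hpow : ((1 + X) ^ 2 + 4 * X : R[X]) ^ m ∈ gammaCone R (2 * m) := by
      simpa [mul_comm] using
        SetLike.pow_mem_graded m (one_add_X_sq_add_four_mul_X_mem_gammaCone (R := R))
    have hA : twistedEulerian (1 : ℤˣ →* R) (2 * m + 1) ∈ gammaCone R (2 * m) := by
      simpa using add_mem ih hpow
    have hstep := eulerianStep_eulerianStep_sub_mem_gammaCone (by omega) hA
    rw [← twistedEulerian_one_succ, ← twistedEulerian_one_succ] at hstep
    have hmul := SetLike.mul_mem_graded ih (one_add_X_sq_add_four_mul_X_mem_gammaCone (R := R))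
    rw [mul_add_one]
    convert add_mem hstep hmul using 1
    ring

theorem twistedEulerian_pair_mem_parityGammaCone {m : ℕ} (hm : 2 ≤ m) :
    (twistedEulerian (1 : ℤˣ →* R) (2 * m + 1), twistedEulerian (signCharacter R) (2 * m + 1)) ∈
      parityGammaCone R (2 * m) := by
  have hpow : (((1 + X) ^ 2 + 4 * X) ^ m, (1 - X : R[X]) ^ (2 * m)) ∈
      parityGammaCone R (2 * m) := by
    have hbase := mk_mem_parityGammaCone (one_add_X_pow_mem_gammaCone 2)
      (four_mul_X_mem_gammaCone (R := R))
    rw [mul_comm 2 m, ← smul_eq_mul m 2]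
    convert SetLike.pow_mem_graded m hbase using 1
    rw [Prod.pow_mk, smul_eq_mul, mul_comm m 2, pow_mul]
    congr 2
    ring
  have hhalf := Submodule.smul_mem _ (2⁻¹ : ℚ≥0)
    (twistedEulerian_one_sub_pow_mem_gammaCone (R := R) hm)
  convert add_mem hpow (mk_mem_parityGammaCone hhalf hhalf) using 1
  rw [Prod.mk_add_mk, ← two_smul ℚ≥0, smul_inv_smul₀ two_ne_zero, sub_self, add_zero,
    add_sub_cancel, twistedEulerian_signCharacter_succ]

end Eulerian

section WeakExcedances

/-- The number of weak excedances of a permutation. -/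
def wexc {n : ℕ} (σ : Equiv.Perm (Fin n)) : ℕ :=
  (Finset.univ.filter fun i : Fin n => i ≤ σ i).card

theorem wexc_eq_exc_finRotate_mul_add_one {n : ℕ} (σ : Equiv.Perm (Fin (n + 1))) :
    wexc σ = exc (finRotate (n + 1) * σ) + 1 := by
  have hinsert : (Finset.univ.filter fun i => i ≤ σ i) = insert (σ⁻¹ (Fin.last n))
      (Finset.univ.filter fun i => i < (finRotate (n + 1) * σ) i) := by
    ext i
    rw [Finset.mem_insert, Finset.mem_filter, Finset.mem_filter, Equiv.Perm.eq_inv_iff_eq,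
      Equiv.Perm.mul_apply, Fin.lt_def, coe_finRotate, Fin.le_def]
    by_cases hi : σ i = Fin.last n
    · simp [hi, Nat.le_of_lt_succ i.2]
    · simp [hi]
  rw [wexc, hinsert, Finset.card_insert_of_notMem, exc]
  rw [Finset.mem_filter_univ, Fin.lt_def, Equiv.Perm.mul_apply, coe_finRotate]
  simp

theorem sum_smul_X_pow_wexc {R : Type*} [CommRing R] (χ : ℤˣ →* R) (m : ℕ) :
    ∑ σ : Equiv.Perm (Fin (2 * m + 1)), χ (Equiv.Perm.sign σ) • X ^ wexc σ =
      X * twistedEulerian χ (2 * m + 1) := by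
  rw [twistedEulerian, excPoly, ← Equiv.sum_comp (Equiv.mulLeft (finRotate (2 * m + 1)))
    (fun σ => χ (Equiv.Perm.sign σ) • (X : R[X]) ^ exc σ), Finset.mul_sum]
  refine Finset.sum_congr rfl fun σ _ => ?_
  -- a cycle of odd length is even, so the rotation does not affect the sign
  rw [wexc_eq_exc_finRotate_mul_add_one, Equiv.coe_mulLeft, Equiv.Perm.sign_mul, sign_finRotate,
    Nat.add_sub_cancel, Even.neg_one_pow (even_two_mul m), one_mul, mul_smul_comm, pow_succ']

end WeakExcedances

section Blocks

theorem exists_prodCongrLeft_eq {α β : Type*} (τ : Equiv.Perm (α × β))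
    (h : ∀ p, (τ p).2 = p.2) : ∃ σ : β → Equiv.Perm α, Equiv.prodCongrLeft σ = τ := by
  have hsymm : ∀ p, (τ.symm p).2 = p.2 := fun p => by
    rw [← h (τ.symm p), Equiv.apply_symm_apply]
  have happly : ∀ x b, ((τ (x, b)).1, b) = τ (x, b) := fun x b => Prod.ext rfl (h (x, b)).symm
  have hsymm_apply : ∀ x b, ((τ.symm (x, b)).1, b) = τ.symm (x, b) :=
    fun x b => Prod.ext rfl (hsymm (x, b)).symm
  refine ⟨fun b => ⟨fun x => (τ (x, b)).1, fun x => (τ.symm (x, b)).1, fun x => ?_, fun x => ?_⟩,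
    ?_⟩
  · simp only [happly, Equiv.symm_apply_apply]
  · simp only [hsymm_apply, Equiv.apply_symm_apply]
  · ext1 ⟨x, b⟩
    exact happly x b

theorem mem_MP_iff_modNat {q k : ℕ} (c : Fin k) (π : Equiv.Perm (Fin (q * k))) :
    π ∈ MP (q * k) k (c + 1) ↔ ∀ i, (π i).modNat = i.modNat + c := by
  rw [MP, Finset.mem_filter_univ]
  refine forall_congr' fun i => ?_
  rw [Fin.ext_iff, Fin.val_add, Fin.coe_modNat, Fin.coe_modNat, Nat.mod_add_mod]
  change _ ↔ _ ≡ _ [MOD k]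
  rw [← Int.natCast_modEq_iff, Int.modEq_iff_dvd, Int.modEq_iff_dvd]
  push_cast
  ring_nf

/-- The shift by `c` of the residue `a` of the number encoded by `(x, a)`, that is of `k x + a`. -/
def residueShift (q : ℕ) {k : ℕ} [NeZero k] (c : Fin k) : Equiv.Perm (Fin q × Fin k) :=
  Equiv.prodCongr (Equiv.refl _) (Equiv.addRight c)

/-- The permutation that acts on the positions of residue `a` modulo `k` by `σ a` and then shifts
the residue by `c`. -/
def blockPerm {q k : ℕ} [NeZero k] (c : Fin k) (σ : Fin k → Equiv.Perm (Fin q)) :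
    Equiv.Perm (Fin (q * k)) :=
  finProdFinEquiv.permCongr ((Equiv.prodCongrLeft σ).trans (residueShift q c))

theorem finProdFinEquiv_lt_iff {q k : ℕ} (x y : Fin q) (a b : Fin k) :
    finProdFinEquiv (x, a) < finProdFinEquiv (y, b) ↔ if a < b then x ≤ y else x < y := by
  simp only [Fin.lt_def, Fin.le_def, finProdFinEquiv_apply_val]
  have ha := a.2
  have hb := b.2
  rcases lt_trichotomy x.1 y.1 with h | h | h
  · have hmul : k * (x.1 + 1) ≤ k * y.1 := Nat.mul_le_mul_left _ h
    grind
  · grind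
  · have hmul : k * (y.1 + 1) ≤ k * x.1 := Nat.mul_le_mul_left _ h
    grind

variable {q k : ℕ} [NeZero k] (c : Fin k) (σ : Fin k → Equiv.Perm (Fin q))

theorem blockPerm_apply (x : Fin q) (a : Fin k) :
    blockPerm c σ (finProdFinEquiv (x, a)) = finProdFinEquiv (σ a x, a + c) := by
  simp [blockPerm, residueShift, Equiv.permCongr_apply]

theorem blockPerm_injective : Function.Injective (blockPerm (q := q) c) := by
  intro σ τ h
  ext a x
  have happly := Equiv.congr_fun h (finProdFinEquiv (x, a))
  rw [blockPerm_apply, blockPerm_apply, EmbeddingLike.apply_eq_iff_eq, Prod.mk.injEq] at happly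
  rw [happly.1]

theorem sign_blockPerm :
    Equiv.Perm.sign (blockPerm c σ) =
      Equiv.Perm.sign (residueShift q c) * ∏ a, Equiv.Perm.sign (σ a) := by
  rw [blockPerm, Equiv.Perm.sign_permCongr, Equiv.Perm.sign_trans, Equiv.Perm.sign_prodCongrLeft]

theorem exc_blockPerm :
    exc (blockPerm c σ) = ∑ a, if a < a + c then wexc (σ a) else exc (σ a) := by
  rw [exc, Finset.card_filter, ← Equiv.sum_comp finProdFinEquiv, Fintype.sum_prod_type_right]
  refine Finset.sum_congr rfl fun a _ => ?_
  simp only [blockPerm_apply, finProdFinEquiv_lt_iff]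
  split_ifs
  · rw [wexc, Finset.card_filter]
  · rw [exc, Finset.card_filter]

theorem MP_eq_map_blockPerm :
    MP (q * k) k (c + 1) = Finset.univ.map ⟨blockPerm (q := q) c, blockPerm_injective c⟩ := by
  ext π
  rw [mem_MP_iff_modNat, Finset.mem_map]
  constructor
  · intro h
    obtain ⟨σ, hσ⟩ := exists_prodCongrLeft_eq
      ((finProdFinEquiv.symm.permCongr π).trans (residueShift q c).symm) (fun p => by
        change (π (finProdFinEquiv p)).modNat + -c = p.2
        rw [h, add_neg_cancel_right]
        exact congrArg Prod.snd (finProdFinEquiv.symm_apply_apply p))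
    refine ⟨σ, Finset.mem_univ _, ?_⟩
    change blockPerm c σ = π
    rw [blockPerm, hσ]
    ext1 i
    simp only [Equiv.permCongr_apply, Equiv.trans_apply, Equiv.apply_symm_apply, Equiv.symm_symm]
  · rintro ⟨σ, -, rfl⟩ i
    obtain ⟨⟨x, a⟩, rfl⟩ := finProdFinEquiv.surjective i
    change (finProdFinEquiv.symm (blockPerm c σ (finProdFinEquiv (x, a)))).2 =
      (finProdFinEquiv.symm (finProdFinEquiv (x, a))).2 + c
    rw [blockPerm_apply, Equiv.symm_apply_apply, Equiv.symm_apply_apply]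

theorem excPoly_MP {R : Type*} [CommRing R] (χ : ℤˣ →* R) (m : ℕ) :
    excPoly χ (MP ((2 * m + 1) * k) k (c + 1)) =
      χ (Equiv.Perm.sign (residueShift (2 * m + 1) c)) •
        (X ^ (Finset.univ.filter fun a : Fin k => a < a + c).card *
          twistedEulerian χ (2 * m + 1) ^ k) := by
  have hblock : ∀ a : Fin k, ∑ σ : Equiv.Perm (Fin (2 * m + 1)), χ (Equiv.Perm.sign σ) •
      (X : R[X]) ^ (if a < a + c then wexc σ else exc σ) =
        (if a < a + c then X else 1) * twistedEulerian χ (2 * m + 1) := by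
    intro a
    split_ifs
    · exact sum_smul_X_pow_wexc χ m
    · rw [one_mul, twistedEulerian, excPoly]
  have hprod : ∏ a : Fin k, ((if a < a + c then X else 1) * twistedEulerian χ (2 * m + 1)) =
      X ^ (Finset.univ.filter fun a : Fin k => a < a + c).card *
        twistedEulerian χ (2 * m + 1) ^ k := by
    rw [Finset.prod_mul_distrib, Finset.prod_const, Finset.card_univ, Fintype.card_fin,
      ← Finset.prod_filter, Finset.prod_const]
  simp only [← hprod, ← hblock]
  rw [Finset.prod_univ_sum, Fintype.piFinset_univ, excPoly, MP_eq_map_blockPerm, Finset.sum_map,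
    Finset.smul_sum]
  refine Finset.sum_congr rfl fun σ _ => ?_
  rw [Function.Embedding.coeFn_mk, sign_blockPerm, exc_blockPerm, Finset.prod_smul,
    Finset.prod_pow_eq_pow_sum, map_mul, map_prod, mul_smul]

theorem card_filter_lt_add (hc : c ≠ 0) :
    (Finset.univ.filter fun a : Fin k => a < a + c).card = k - c := by
  have hlt : ∀ a : Fin k, a < a + c ↔ a.1 < k - c := fun a => by
    have hc := Fin.val_ne_zero_iff.2 hc
    rw [Fin.lt_def, Fin.val_add_eq_ite]
    split_ifs <;> omega
  simp only [hlt]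
  rw [Fin.card_filter_val_lt]
  exact min_eq_right (Nat.sub_le _ _)

end Blocks

section ModAlternating

theorem MPEplus_eq_signPart (n k r : ℕ) : MPEplus n k r = signPart ℚ (MP n k r) 1 := by
  simp only [MPEplus, signPart, Equiv.Perm.mem_alternatingGroup]

theorem MPEminus_eq_signPart (n k r : ℕ) : MPEminus n k r = signPart ℚ (MP n k r) (-1) := by
  simp only [MPEminus, signPart, Equiv.Perm.mem_alternatingGroup, Int.units_ne_iff_eq_neg]

variable {k : ℕ} [NeZero k] (c : Fin k) {m : ℕ}

theorem excPoly_MP_pair_mem_parityGammaCone {R : Type*} [CommRing R] [Algebra ℚ≥0 R]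
    (hm : 2 ≤ m) :
    (excPoly (1 : ℤˣ →* R) (MP ((2 * m + 1) * k) k (c + 1)),
      excPoly (signCharacter R) (MP ((2 * m + 1) * k) k (c + 1))) ∈
      parityGammaCone R
        (2 * (Finset.univ.filter fun a : Fin k => a < a + c).card + k * (2 * m)) := by
  have hX := mk_mem_parityGammaCone (R := R)
    (X_pow_mem_gammaCone (Finset.univ.filter fun a : Fin k => a < a + c).card) (zero_mem _)
  rw [add_zero, sub_zero] at hX
  have hpow := SetLike.pow_mem_graded k (twistedEulerian_pair_mem_parityGammaCone (R := R) hm)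
  rw [excPoly_MP, excPoly_MP, signCharacter_smul, MonoidHom.one_apply, one_smul]
  exact mk_units_smul_mem_parityGammaCone (SetLike.mul_mem_graded hX hpow) _

theorem signPart_MP_ne_zero (hm : m ≠ 0) (δ : ℤˣ) :
    signPart ℚ (MP ((2 * m + 1) * k) k (c + 1)) δ ≠ 0 := by
  apply signPart_ne_zero
  · rw [eval_one_excPoly_one, MP_eq_map_blockPerm, Finset.card_map, Nat.cast_ne_zero]
    exact Fintype.card_ne_zero
  · rw [excPoly_MP, twistedEulerian_signCharacter_succ]
    simp [hm, NeZero.ne k]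

theorem isGammaPositive_signPart_MP (hm : 2 ≤ m) (δ : ℤˣ) :
    IsGammaPositive (signPart ℚ (MP ((2 * m + 1) * k) k (c + 1)) δ) ∧
      centerOfSymmetry (signPart ℚ (MP ((2 * m + 1) * k) k (c + 1)) δ) =
        (Finset.univ.filter fun a : Fin k => a < a + c).card + m * k := by
  have hmem := signPart_mem_gammaCone δ (excPoly_MP_pair_mem_parityGammaCone (R := ℚ) c hm)
  have hne := signPart_MP_ne_zero c (by omega : m ≠ 0) δ
  refine ⟨isGammaPositive_of_mem_gammaCone hmem hne, ?_⟩
  rw [centerOfSymmetry_of_mem_gammaCone hmem hne]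
  push_cast
  ring

theorem isGammaPositive_signPart_MP_one (hm : 2 ≤ m) (δ : ℤˣ) :
    IsGammaPositive (signPart ℚ (MP ((2 * m + 1) * k) k 1) δ) ∧
      centerOfSymmetry (signPart ℚ (MP ((2 * m + 1) * k) k 1) δ) =
        (((2 * m + 1) * k : ℕ) - (k : ℚ)) / 2 := by
  have hzero := isGammaPositive_signPart_MP (0 : Fin k) hm δ
  rw [Fin.val_zero, zero_add] at hzero
  refine ⟨hzero.1, hzero.2.trans ?_⟩
  simp only [add_zero, lt_irrefl, Finset.filter_false, Finset.card_empty]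
  push_cast
  ring

theorem isGammaPositive_signPart_MP_of_two_le (hm : 2 ≤ m) {r : ℕ} (hr : 2 ≤ r) (hrk : r ≤ k)
    (δ : ℤˣ) :
    IsGammaPositive (signPart ℚ (MP ((2 * m + 1) * k) k r) δ) ∧
      centerOfSymmetry (signPart ℚ (MP ((2 * m + 1) * k) k r) δ) =
        (((2 * m + 1) * k : ℕ) + (k : ℚ)) / 2 + 1 - r := by
  obtain ⟨c, rfl⟩ : ∃ c, r = c + 1 := ⟨r - 1, by omega⟩
  have hc : (⟨c, hrk⟩ : Fin k) ≠ 0 := Fin.val_ne_zero_iff.1 (by simp only; omega)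
  obtain ⟨hpos, hcenter⟩ := isGammaPositive_signPart_MP ⟨c, hrk⟩ hm δ
  refine ⟨hpos, hcenter.trans ?_⟩
  rw [card_filter_lt_add _ hc, Nat.cast_sub (by simp only; omega)]
  push_cast
  ring

end ModAlternating

theorem mainTheorem4 (n k : ℕ) (hk : 0 < k) (hnk : n ≡ k [MOD 2 * k]) (hn : 5 * k ≤ n) :
    ((IsGammaPositive (MPEplus n k 1) ∧
        centerOfSymmetry (MPEplus n k 1) = ((n : ℚ) - (k : ℚ)) / 2) ∧
      (IsGammaPositive (MPEminus n k 1) ∧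
        centerOfSymmetry (MPEminus n k 1) = ((n : ℚ) - (k : ℚ)) / 2)) ∧
    ∀ r : ℕ, 2 ≤ r → r ≤ k →
      ((IsGammaPositive (MPEplus n k r) ∧
          centerOfSymmetry (MPEplus n k r) = ((n : ℚ) + (k : ℚ)) / 2 + 1 - (r : ℚ)) ∧
        (IsGammaPositive (MPEminus n k r) ∧
          centerOfSymmetry (MPEminus n k r) = ((n : ℚ) + (k : ℚ)) / 2 + 1 - (r : ℚ))) := by
  have : NeZero k := ⟨hk.ne'⟩
  obtain ⟨m, hm⟩ := (Nat.modEq_iff_dvd' (show k ≤ n by omega)).1 hnk.symm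
  obtain rfl : n = (2 * m + 1) * k := by
    have : (2 * m + 1) * k = 2 * k * m + k := by ring
    omega
  have hm2 : 2 ≤ m := by
    have := Nat.le_of_mul_le_mul_right hn hk
    omega
  simp only [MPEplus_eq_signPart, MPEminus_eq_signPart]
  have hzero := isGammaPositive_signPart_MP_one (k := k) hm2
  have hshift := fun r hr hrk => isGammaPositive_signPart_MP_of_two_le (k := k) (r := r) hm2 hr hrk
  exact ⟨⟨hzero 1, hzero (-1)⟩, fun r hr hrk => ⟨hshift r hr hrk 1, hshift r hr hrk (-1)⟩⟩
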